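/- **Setting.** Let $d,N\ge 0$ be integers and let $B_1,\dots,B_d$ be smooth functions from $\mathbb R^d$ to the $N\times N$ matrices over $\mathbb R$ or $\mathbb C$. Put $$D_\mu f=\partial_\mu f+B_\mu f,\qquad \nabla_\mu f=\partial_\mu f+[B_\mu,f],\qquad F_{\nu\mu}=\partial_\nu B_\mu-\partial_\mu B_\nu+[B_\nu,B_\mu].$$ Sums over repeated indices are understood. Let $$\Phi(x,y)=1+\sum_{n\ge1}(-1)^n\int_0^1\!\!\cdots\!\int_0^1 ds_1\cdots ds_n\,\frac{dz_1^{\nu_1}}{ds_1}\cdots\frac{dz_n^{\nu_n}}{ds_n}\,B_{\nu_1}(z_1)\cdots B_{\nu_n}(z_n),\qquad z_j=(1-s_j)y+s_jz_{j-1},\ z_0=x,$$ be the P-ordered exponential along the segment from $y$ to $x$. **Diagrams.** A diagram is a finite sequence $v_1,\dots,v_m$ ($m\ge0$) of vertices, each carrying a power $p_a\in\{0,1,2,\dots\}$. A vertex is either a circle with a nonempty sequence of indices $\mu_1\cdots\mu_n$ or a cross. We require $p_a\ge1$, except that a circle with a single index may have $p_a=0$. The diagram has $i=m+1$ lines: one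 to the left of $v_1$, one between any two neighbouring vertices and one to the right of $v_m$. For fixed $y\in\mathbb R^d$ it represents the following function of $x$. Put $z_0=x$, $z_a=(1-s_a)y+s_az_{a-1}$ and $z_{m+1}=y$; then $$V(x)=\int_0^1\!\!\cdots\!\int_0^1 \Phi(z_0,z_1)\,C_1\,\Phi(z_1,z_2)\,C_2\cdots C_m\,\Phi(z_m,z_{m+1}),$$ an iterated integral over $s_1,\dots,s_m$, where $C_a=s_a^{p_a-1}\,ds_a$ for a cross and, for a circle, $$C_a=s_a^{p_a}\,\nabla_{\mu_1}\cdots\nabla_{\mu_{n-1}}\bigl(d(z-y)^\nu F_{\nu\mu_n}(z)\bigr)\Big|_{z=z_a},\qquad d(z-y)^\nu=(z-y)^\nu\,\frac{ds_a}{s_a},$$ the operators $\nabla$ acting on $z$ with $s_a$ fixed. **The derivative acting on one element.** In $V$, write $z_a=y+\sigma_a(x-y)$ with $\sigma_a=s_1\cdots s_a$ for $0\le a\le m$ (so $\sigma_0=1$). The part of $D_\rho V$ in which the derivative acts on the line between $z_a$ and $z_{a+1}$ is obtained from the integral for $V$ by replacing the factor $\Phi(z_a,z_{a+1})$ with $$\partial_{x^\rho}\bigl[\Phi(z_a,z_{a+1})\bigr]+\sigma_aB_\rho(z_a)\Phi(z_a,z_{a+1})-\sigma_{a+1}\Phi(z_a,z_{a+1})B_\rho(z_{a+1}),$$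 where the last term is absent for the rightmost line ($a=m$). The part in which it acts on the vertex $v_a$ is obtained by replacing $C_a$ with $\sigma_a\nabla_\rho C_a$, where $\nabla_\rho$ acts on $z=z_a$ and a cross counts as the constant matrix function $s_a^{p_a-1}\cdot 1$ of $z$. **Theorem.** Take any diagram with $i$ lines, $k$ circles and any number of crosses, fix $y\in\mathbb R^d$, and let $V$ be the function of $x$ that it represents. Then $V$ is differentiable, and for every $\rho\in\{1,\dots,d\}$ the function $D_\rho V$ is the sum of the parts in which $D_\rho$ acts on the individual lines and vertices. These parts are as follows. 1. The part in which $D_\rho$ acts on a line equals the diagram obtained by inserting into this line a new circle (with a line on either side of it) with the single index $\rho$ and with power $p+1$, where $p$ is the power of the nearest vertex to the right of the line; the power of the new circle is $1$ if the line is the rightmost one. Moreover, the power of every vertex to the left of the line is raised by $1$. 2. The part in which $D_\rho$ acts on a circle equals the diagram obtained by attaching $\rho$ on the left of the indices of this circle and raising by $1$ its power and the power of every vertex to its left. 3. The part in which $D_\rho$ acts on a cross is zero. Consequently $D_\rho V$ is the sum of $i+k$ diagrams, one for each line and one for each circle, and these again satisfy the above requirement on the powers. -/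

import Mathlib

open scoped ContDiff

noncomputable section

namespace HeatDiagram

/-- The flat space `ℝ^d`. -/
abbrev Space (d : ℕ) : Type := EuclideanSpace ℝ (Fin d)

/-- The point `z(s) = (1 - s) y + s x` of the segment from `y` to `x`. -/
def seg {d : ℕ} (y x : Space d) (s : ℝ) : Space d := (1 - s) • y + s • x

section Fields

variable {d : ℕ} {A : Type*} [NormedRing A] [NormedAlgebra ℝ A]

/-- The partial derivative `∂_μ f`. -/
def pd (μ : Fin d) (f : Space d → A) (x : Space d) : A :=
  fderiv ℝ f x (EuclideanSpace.single μ (1 : ℝ))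

/-- The covariant derivative `D_μ f = ∂_μ f + B_μ f`. -/
def covD (B : Fin d → Space d → A) (μ : Fin d) (f : Space d → A) (x : Space d) : A :=
  pd μ f x + B μ x * f x

/-- The operator `∇_μ f = ∂_μ f + [B_μ, f]`. -/
def nabla (B : Fin d → Space d → A) (μ : Fin d) (f : Space d → A) (x : Space d) : A :=
  pd μ f x + (B μ x * f x - f x * B μ x)

/-- The field strength `F_{νμ} = ∂_ν B_μ - ∂_μ B_ν + [B_ν, B_μ]`. -/
def fieldStrength (B : Fin d → Space d → A) (ν μ : Fin d) (x : Space d) : A :=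
  pd ν (B μ) x - pd μ (B ν) x + (B ν x * B μ x - B μ x * B ν x)

/-- The `n`-th term of the P-exponential, i.e. `(-1)^n` times the `n`-fold iterated integral of
`dz_1^{ν_1}/ds_1 ⋯ dz_n^{ν_n}/ds_n B_{ν_1}(z_1) ⋯ B_{ν_n}(z_n)` over `s_1, …, s_n ∈ [0, 1]`, where
`z_j = (1 - s_j) y + s_j z_{j-1}` and `z_0 = x`. -/
def pexpTerm (B : Fin d → Space d → A) : ℕ → Space d → Space d → A
  | 0, _, _ => 1
  | n + 1, x, y =>
      -∫ s in (0 : ℝ)..1,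
        (∑ ν : Fin d, (x ν - y ν) • B ν (seg y x s)) * pexpTerm B n (seg y x s) y

/-- The P-ordered exponential `Φ(x, y)` along the segment joining `y` and `x`. -/
def pexp (B : Fin d → Space d → A) (x y : Space d) : A :=
  ∑' n : ℕ, pexpTerm B n x y

/-- `∇_{μ_1} ⋯ ∇_{μ_{n-1}} ((z - y)^ν F_{ν μ_n}(z) / s)`, with all operators acting on `z`.  It is
the coefficient of `ds` in `∇_{μ_1} ⋯ ∇_{μ_{n-1}} (d(z - y)^ν F_{ν μ_n}(z))`: on the line
`z = (1 - s) y + s x` one has `d(z - y) = (x - y) ds = (z - y) ds / s`. -/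
def circleForm (B : Fin d → Space d → A) (y : Space d) (s : ℝ) :
    List (Fin d) → Fin d → Space d → A
  | [], μ => fun z => ∑ ν : Fin d, (s⁻¹ * (z ν - y ν)) • fieldStrength B ν μ z
  | μ₁ :: μs, μ => nabla B μ₁ (circleForm B y s μs μ)

end Fields

/-- The two kinds of vertices.  `circle [μ_1, …, μ_{n-1}] μ_n` is the circle with the (nonempty)
sequence of indices `μ_1 ⋯ μ_n`. -/
inductive Node (d : ℕ) : Type
  | circle (front : List (Fin d)) (last : Fin d) : Node d
  | cross : Node d

/-- A vertex: its kind and the power `k` of the parameterization weight `s^k`. -/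
structure Vertex (d : ℕ) : Type where
  node : Node d
  power : ℕ

namespace Vertex

variable {d : ℕ}

/-- Is the vertex a circle? -/
def isCircle : Vertex d → Bool
  | ⟨.circle _ _, _⟩ => true
  | ⟨.cross, _⟩ => false

/-- The powers for which the integral over the vertex converges: positive ones, and for a circle
with one index also `0` (then `d(z - y)^ν F_{νμ} = (x - y)^ν F_{νμ} ds` has no factor `1 / s`). -/
def Admissible : Vertex d → Prop
  | ⟨.circle [] _, _⟩ => True
  | ⟨.circle (_ :: _) _, k⟩ => 1 ≤ k
  | ⟨.cross, k⟩ => 1 ≤ k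

/-- Raise the power of the weight by one. -/
def raise (v : Vertex d) : Vertex d := ⟨v.node, v.power + 1⟩

/-- Put `ρ` to the left of the indices of a circle and raise its power by one (crosses are left
alone; this is only used for circles). -/
def attach (ρ : Fin d) : Vertex d → Vertex d
  | ⟨.circle μs μ, k⟩ => ⟨.circle (ρ :: μs) μ, k + 1⟩
  | ⟨.cross, k⟩ => ⟨.cross, k⟩

/-- The factor that a vertex contributes at the point `z`, weight included, as the coefficient of
`ds`: `s^k ∇_{μ_1} ⋯ ∇_{μ_{n-1}} (d(z - y)^ν F_{ν μ_n}(z)) / ds` for a circle and `s^{k-1}` for a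
cross. -/
def form {A : Type*} [NormedRing A] [NormedAlgebra ℝ A] (B : Fin d → Space d → A) (y : Space d)
    (s : ℝ) : Vertex d → Space d → A
  | ⟨.circle μs μ, k⟩ => fun z => s ^ k • circleForm B y s μs μ z
  | ⟨.cross, k⟩ => fun _ => (s ^ k * s⁻¹) • (1 : A)

end Vertex

/-- A diagram, as the sequence of its vertices from left (`x`) to right (`y`).  There is one line to
the left of the first vertex, one between any two neighbours, and one to the right of the last
vertex; line `l` is the one with exactly `l` vertices to its left. -/
abbrev Diagram (d : ℕ) : Type := List (Vertex d)

namespace Diagram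

variable {d : ℕ}

/-- The number of lines. -/
def numLines (D : Diagram d) : ℕ := D.length + 1

/-- The number of circles. -/
def numCircles (D : Diagram d) : ℕ := D.countP Vertex.isCircle

/-- All powers are admissible. -/
def Admissible (D : Diagram d) : Prop := ∀ v ∈ D, v.Admissible

/-- The power at the first vertex of a diagram, `0` if there is no vertex. -/
def headPower : Diagram d → ℕ
  | [] => 0
  | v :: _ => v.power

/-- The diagram that arises when the derivative acts on line `l`. -/
def diffLine (ρ : Fin d) (D : Diagram d) (l : ℕ) : Diagram d :=
  (D.take l).map Vertex.raise ++
    ⟨Node.circle [] ρ, headPower (D.drop l) + 1⟩ :: D.drop l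

/-- The diagram that arises when the derivative acts on vertex `c`, if this is a circle. -/
def diffCircle (ρ : Fin d) (D : Diagram d) (c : Fin D.length) : Diagram d :=
  (D.take c).map Vertex.raise ++ (D.get c).attach ρ :: D.drop (c + 1)

/-- All diagrams that arise: one for each line and one for each circle. -/
def derivative (ρ : Fin d) (D : Diagram d) : List (Diagram d) :=
  (List.range D.numLines).map (D.diffLine ρ) ++
    ((List.finRange D.length).filter fun c => (D.get c).isCircle).map (D.diffCircle ρ)

section Value

variable {A : Type*} [NormedRing A] [NormedAlgebra ℝ A]

/-- The function of `(x, y)` represented by a diagram: lines are P-exponentials, and each vertex is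
integrated over the segment from `y` to the nearest point on the left. -/
def value (B : Fin d → Space d → A) : Diagram d → Space d → Space d → A
  | [], x, y => pexp B x y
  | v :: D, x, y =>
      ∫ s in (0 : ℝ)..1,
        pexp B x (seg y x s) * v.form B y s (seg y x s) * value B D (seg y x s) y

/-- The part of `D_ρ` of a diagram in which the derivative acts on line `l`.  If the line joins
`u = y + a (x - y)` and `w = y + b (x - y)`, then its factor `Φ(u, w)` is replaced by
`∂_{x^ρ} Φ(u, w) + a B_ρ(u) Φ(u, w) - b Φ(u, w) B_ρ(w)`; the last term is absent for the rightmost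
line, where `w = y`.  The variables with the chain-rule factor are rescaled one vertex at a time. -/
def actLine (B : Fin d → Space d → A) (ρ : Fin d) : Diagram d → ℕ → Space d → Space d → A
  | [], _, x, y => covD B ρ (fun x' => pexp B x' y) x
  | v :: D, 0, x, y =>
      ∫ s in (0 : ℝ)..1,
        (pd ρ (fun x' => pexp B x' (seg y x' s)) x + B ρ x * pexp B x (seg y x s)
            - s • (pexp B x (seg y x s) * B ρ (seg y x s)))
          * v.form B y s (seg y x s) * value B D (seg y x s) y
  | v :: D, l + 1, x, y =>
      ∫ s in (0 : ℝ)..1,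
        pexp B x (seg y x s) * v.form B y s (seg y x s)
          * (s • actLine B ρ D l (seg y x s) y)

/-- The part of `D_ρ` of a diagram in which the derivative acts on vertex `c`: the factor at the
vertex at `z = y + b (x - y)` is replaced by `b` times its derivative `∇_ρ` in `z`. -/
def actVertex (B : Fin d → Space d → A) (ρ : Fin d) : Diagram d → ℕ → Space d → Space d → A
  | [], _, _, _ => 0
  | v :: D, 0, x, y =>
      ∫ s in (0 : ℝ)..1,
        pexp B x (seg y x s) * (s • nabla B ρ (v.form B y s) (seg y x s))
          * value B D (seg y x s) y
  | v :: D, c + 1, x, y =>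
      ∫ s in (0 : ℝ)..1,
        pexp B x (seg y x s) * v.form B y s (seg y x s)
          * (s • actVertex B ρ D c (seg y x s) y)

end Value

end Diagram

end HeatDiagram

end

/- Smoothness, derivatives and integrals of matrix-valued functions do not depend on the norm. -/
attribute [local instance] Matrix.linftyOpNormedRing Matrix.linftyOpNormedAlgebra

/-! Restricted to the line through `y` and `x`, the P-exponential is the propagator of a linear ODE.
Summing its series gives a Volterra equation (`transport_eq`), and ODE uniqueness then gives the
composition law `transport_mul`, invertibility, and the derivative in either endpoint. Duhamel's
formula (`transport_sub_transport`) gives the derivative in `x`. Adding the boundary terms, written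
as the integral of a total derivative, turns this into an integral of the field strength between two
transports (`covariant_pd_transport`). This is the new circle on a line.

The powers are a matter of scaling. Under `s = t * u`, a vertex of power `p` contributes `t ^ p`
(`Vertex.smul_form_mul`). If the first line ends at parameter `s` and the new circle sits at `t`
with `s < t`, exchanging the integrals puts `t` outermost. What remains to its right is `t ^ p`
times the old diagram with `x` moved to `seg y x t`; with the factor `t` from the field-strength
formula this makes the power `p + 1`. Deeper in the diagram, each chain-rule factor `s` is absorbed
by raising the power of a vertex to the left. At a circle the factor `s` combines with `nabla`; at a
cross `nabla` gives zero.

Analytically, admissibility makes every vertex form agree, away from `s = 0`, with a family that is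
C¹ in `x` (`Vertex.Admissible.exists_c1Param`). Hence the outer integral can be differentiated under
the integral sign, and `covD_value` follows by the Leibniz rule and induction on the vertices. -/

namespace HeatDiagram

/-! ### Parallel transport along a line as the propagator of a linear ODE. -/

section Transport

variable {d : ℕ} {A : Type*} [NormedRing A] [NormedAlgebra ℝ A]

/-- The component of the connection along the segment from `y` to `x`. -/
noncomputable def tangential (B : Fin d → Space d → A) (y x : Space d) (t : ℝ) : A :=
  ∑ ν : Fin d, (x ν - y ν) • B ν (seg y x t)

theorem seg_seg (y x : Space d) (s t r : ℝ) :
    seg (seg y x s) (seg y x t) r = seg y x (s + (t - s) * r) := by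
  ext i
  simp [seg]
  ring

theorem seg_zero (y x : Space d) : seg y x 0 = y := by simp [seg]

theorem seg_one (y x : Space d) : seg y x 1 = x := by simp [seg]

theorem seg_seg_right (y x : Space d) (t r : ℝ) : seg y (seg y x t) r = seg y x (t * r) := by
  have := seg_seg y x 0 t r
  simpa [seg_zero] using this

theorem seg_sub_apply (y x : Space d) (t : ℝ) (ν : Fin d) :
    seg y x t ν - y ν = t * (x ν - y ν) := by
  simp [seg]
  ring

@[fun_prop]
theorem Continuous.seg {X : Type*} [TopologicalSpace X] {f g : X → Space d} {h : X → ℝ}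
    (hf : Continuous f) (hg : Continuous g) (hh : Continuous h) :
    Continuous fun a => seg (f a) (g a) (h a) := by
  unfold HeatDiagram.seg
  fun_prop

/-- The connection is a one-form, so an affine change of parameter multiplies its tangential
component by the speed `t - s`. -/
theorem tangential_seg (B : Fin d → Space d → A) (y x : Space d) (s t r : ℝ) :
    tangential B (seg y x s) (seg y x t) r = (t - s) • tangential B y x (s + (t - s) * r) := by
  unfold tangential
  rw [Finset.smul_sum]
  refine Finset.sum_congr rfl fun ν _ => ?_
  rw [seg_seg, smul_smul]
  congr 1
  simp [seg]
  ring

@[fun_prop]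
theorem Continuous.tangential {B : Fin d → Space d → A} (hB : ∀ μ, Continuous (B μ))
    {X : Type*} [TopologicalSpace X] {f g : X → Space d} {h : X → ℝ}
    (hf : Continuous f) (hg : Continuous g) (hh : Continuous h) :
    Continuous fun a => tangential B (f a) (g a) (h a) := by
  unfold HeatDiagram.tangential
  refine continuous_finsetSum _ fun ν _ => ?_
  have := hB ν
  fun_prop

theorem pexpTerm_succ (B : Fin d → Space d → A) (n : ℕ) (x y : Space d) :
    pexpTerm B (n + 1) x y =
      -∫ s in (0 : ℝ)..1, tangential B y x s * pexpTerm B n (seg y x s) y := rfl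

theorem continuous_pexpTerm {B : Fin d → Space d → A} (hB : ∀ μ, Continuous (B μ)) (n : ℕ) :
    Continuous fun p : Space d × Space d => pexpTerm B n p.1 p.2 := by
  induction n with
  | zero => exact continuous_const
  | succ n ih =>
    simp only [pexpTerm_succ]
    refine Continuous.neg ?_
    refine intervalIntegral.continuous_parametric_intervalIntegral_of_continuous' ?_ _ _
    refine Continuous.mul ?_ ?_
    · have := hB
      fun_prop (disch := assumption)
    · exact ih.comp (f := fun q : (Space d × Space d) × ℝ => (seg q.1.2 q.1.1 q.2, q.1.2))
        (by fun_prop)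

theorem exists_norm_tangential_le {B : Fin d → Space d → A} (hB : ∀ μ, Continuous (B μ)) (R : ℝ) :
    ∃ M, 0 ≤ M ∧ ∀ u w : Space d, ‖u‖ ≤ R → ‖w‖ ≤ R → ∀ s ∈ Set.Icc (0 : ℝ) 1,
      ‖tangential B w u s‖ ≤ M := by
  have hc : IsCompact ((Metric.closedBall (0 : Space d) R) ×ˢ
      ((Metric.closedBall (0 : Space d) R) ×ˢ (Set.Icc (0 : ℝ) 1))) :=
    (isCompact_closedBall _ _).prod ((isCompact_closedBall _ _).prod isCompact_Icc)
  obtain ⟨M, hM⟩ := hc.exists_bound_of_continuousOn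
    (f := fun p : Space d × Space d × ℝ => tangential B p.1 p.2.1 p.2.2)
    (by have := hB
        exact Continuous.continuousOn (by fun_prop (disch := assumption)))
  refine ⟨max M 0, le_max_right _ _, fun u w hu hw s hs => ?_⟩
  exact (hM (w, u, s) ⟨by simpa using hw, by simpa using hu, hs⟩).trans (le_max_left _ _)

/-- The recursion moves the endpoint from `r` to `r * s`, so the induction needs all `r` at once;
the integral of `s ^ n` supplies the next factor of the factorial. -/
theorem norm_pexpTerm_seg_le (B : Fin d → Space d → A) {u w : Space d} {M : ℝ} (hM0 : 0 ≤ M)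
    (hM : ∀ s ∈ Set.Icc (0 : ℝ) 1, ‖tangential B w u s‖ ≤ M) (n : ℕ) :
    ∀ r ∈ Set.Icc (0 : ℝ) 1,
      ‖pexpTerm B n (seg w u r) w‖ ≤ ‖(1 : A)‖ * ((M * r) ^ n / n.factorial) := by
  induction n with
  | zero => intro r _; simp [pexpTerm]
  | succ n ih =>
    intro r hr
    rw [pexpTerm_succ, norm_neg]
    have key : ∀ s ∈ Set.Ioc (0 : ℝ) 1,
        ‖tangential B w (seg w u r) s * pexpTerm B n (seg w (seg w u r) s) w‖ ≤
          (‖(1 : A)‖ * (M * r) ^ (n + 1) / n.factorial) * s ^ n := by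
      intro s hs
      have hrs : r * s ∈ Set.Icc (0 : ℝ) 1 :=
        ⟨mul_nonneg hr.1 hs.1.le, mul_le_one₀ hr.2 hs.1.le hs.2⟩
      have h1 : ‖tangential B w (seg w u r) s‖ ≤ r * M := by
        have := tangential_seg B w u 0 r s
        simp only [seg_zero, sub_zero, zero_add] at this
        rw [this, norm_smul, Real.norm_of_nonneg hr.1]
        exact mul_le_mul_of_nonneg_left (hM _ hrs) hr.1
      have h2 := ih _ hrs
      rw [seg_seg_right]
      calc _ ≤ _ := norm_mul_le _ _
        _ ≤ (r * M) * (‖(1 : A)‖ * ((M * (r * s)) ^ n / n.factorial)) :=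
          mul_le_mul h1 h2 (norm_nonneg _) (mul_nonneg hr.1 hM0)
        _ = _ := by ring
    refine (intervalIntegral.norm_integral_le_of_norm_le zero_le_one
      (Filter.Eventually.of_forall key) ?_).trans ?_
    · exact (Continuous.intervalIntegrable (by fun_prop) _ _)
    · rw [intervalIntegral.integral_const_mul, integral_pow]
      rw [Nat.factorial_succ]
      have : (n.factorial : ℝ) ≠ 0 := by positivity
      have : (n : ℝ) + 1 ≠ 0 := by positivity
      apply le_of_eq
      push_cast
      simp
      field_simp

theorem linear_ode_unique {b f g : ℝ → A} (hb : Continuous b)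
    (hf : ∀ t, HasDerivAt f (-(b t * f t)) t) (hg : ∀ t, HasDerivAt g (-(b t * g t)) t) {t₀ : ℝ}
    (h : f t₀ = g t₀) : f = g := by
  funext t
  obtain ⟨K, hK⟩ := (isCompact_Icc (a := min t t₀ - 1) (b := max t t₀ + 1)).exists_bound_of_continuousOn
    hb.continuousOn
  have hl := min_le_left t t₀
  have hl' := min_le_right t t₀
  have hr := le_max_left t t₀
  have hr' := le_max_right t t₀
  -- The interval is widened by one on each side because `t₀` must lie in its interior; the bound
  -- `K` of `b` there is a Lipschitz constant.
  refine ODE_solution_unique_of_mem_Icc (v := fun t z => -(b t * z)) (s := fun _ => Set.univ)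
    (K := K.toNNReal) (a := min t t₀ - 1) (b := max t t₀ + 1) (t₀ := t₀) ?_
    ⟨by linarith, by linarith⟩
    (HasDerivAt.continuousOn fun t _ => hf t) (fun t _ => hf t) (fun _ _ => trivial)
    (HasDerivAt.continuousOn fun t _ => hg t) (fun t _ => hg t) (fun _ _ => trivial) h
    ⟨by linarith, by linarith⟩
  intro r hr
  refine LipschitzWith.lipschitzOnWith (LipschitzWith.of_dist_le_mul fun z w => ?_)
  rw [dist_neg_neg, dist_eq_norm, dist_eq_norm, ← mul_sub]
  refine (norm_mul_le _ _).trans (mul_le_mul_of_nonneg_right ?_ (norm_nonneg _))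
  exact (hK r ⟨hr.1.le, hr.2.le⟩).trans (Real.le_coe_toNNReal K)

variable [CompleteSpace A]

theorem summable_pexpTerm {B : Fin d → Space d → A} (hB : ∀ μ, Continuous (B μ))
    (x y : Space d) : Summable fun n => pexpTerm B n x y := by
  obtain ⟨M, hM0, hM⟩ := exists_norm_tangential_le hB (max ‖x‖ ‖y‖)
  refine Summable.of_norm_bounded ((Real.summable_pow_div_factorial M).mul_left ‖(1 : A)‖)
    fun n => ?_
  have := norm_pexpTerm_seg_le B hM0 (hM x y (le_max_left _ _) (le_max_right _ _)) n 1 (by simp)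
  simpa [seg_one] using this

theorem continuous_pexp {B : Fin d → Space d → A} (hB : ∀ μ, Continuous (B μ)) :
    Continuous fun p : Space d × Space d => pexp B p.1 p.2 := by
  rw [continuous_iff_continuousAt]
  intro p
  obtain ⟨M, hM0, hM⟩ := exists_norm_tangential_le hB (‖p‖ + 1)
  have : ContinuousOn (fun p : Space d × Space d => pexp B p.1 p.2) (Metric.ball p 1) := by
    refine continuousOn_tsum (fun n => (continuous_pexpTerm hB n).continuousOn)
      ((Real.summable_pow_div_factorial M).mul_left ‖(1 : A)‖) fun n q hq => ?_
    have hq : ‖q‖ ≤ ‖p‖ + 1 := by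
      have h1 : ‖q - p‖ < 1 := by simpa [dist_eq_norm] using hq
      have h2 := norm_le_insert' q p
      linarith
    have := norm_pexpTerm_seg_le B hM0 (hM q.1 q.2 ((norm_fst_le q).trans hq)
      ((norm_snd_le q).trans hq)) n 1 (by simp)
    simpa [seg_one] using this
  exact this.continuousAt (Metric.ball_mem_nhds _ one_pos)

@[fun_prop]
theorem Continuous.pexp {B : Fin d → Space d → A} (hB : ∀ μ, Continuous (B μ))
    {X : Type*} [TopologicalSpace X] {f g : X → Space d}
    (hf : Continuous f) (hg : Continuous g) : Continuous fun a => pexp B (f a) (g a) :=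
  (continuous_pexp hB).comp (hf.prodMk hg)

/-- Sum the recursion for the terms; the factorial bound dominates the exchange of sum and integral.
-/
theorem pexp_eq_one_sub_integral {B : Fin d → Space d → A} (hB : ∀ μ, Continuous (B μ))
    (x y : Space d) :
    pexp B x y = 1 - ∫ s in (0 : ℝ)..1, tangential B y x s * pexp B (seg y x s) y := by
  obtain ⟨M, hM0, hM⟩ := exists_norm_tangential_le hB (max ‖x‖ ‖y‖)
  replace hM := hM x y (le_max_left _ _) (le_max_right _ _)
  have h1 : HasSum (fun n => ∫ s in (0 : ℝ)..1, tangential B y x s * pexpTerm B n (seg y x s) y)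
      (∫ s in (0 : ℝ)..1, tangential B y x s * pexp B (seg y x s) y) := by
    refine intervalIntegral.hasSum_integral_of_dominated_convergence
      (fun n _ => M * (‖(1 : A)‖ * (M ^ n / n.factorial))) (fun n => ?_) (fun n => ?_) ?_ ?_ ?_
    · have h2 : Continuous fun s => tangential B y x s * pexpTerm B n (seg y x s) y := by
        refine Continuous.mul (by fun_prop (disch := assumption)) ?_
        exact (continuous_pexpTerm hB n).comp (f := fun s : ℝ => (seg y x s, y)) (by fun_prop)
      exact h2.aestronglyMeasurable
    · refine Filter.Eventually.of_forall fun s hs => ?_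
      rw [Set.uIoc_of_le zero_le_one] at hs
      have hs' : s ∈ Set.Icc (0 : ℝ) 1 := ⟨hs.1.le, hs.2⟩
      refine (norm_mul_le _ _).trans (mul_le_mul (hM _ hs') ?_ (norm_nonneg _) hM0)
      refine (norm_pexpTerm_seg_le B hM0 hM n s hs').trans ?_
      have : M * s ≤ M := mul_le_of_le_one_right hM0 hs.2
      have : 0 ≤ M * s := mul_nonneg hM0 hs.1.le
      gcongr
    · exact Filter.Eventually.of_forall fun s _ =>
        ((Real.summable_pow_div_factorial M).mul_left _).mul_left _
    · simp
    · exact Filter.Eventually.of_forall fun s _ => (summable_pexpTerm hB _ _).hasSum.mul_left _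
  rw [pexp, (summable_pexpTerm hB x y).tsum_eq_zero_add]
  simp only [pexpTerm_succ]
  rw [tsum_neg, h1.tsum_eq, sub_eq_add_neg]
  rfl

/-- The parallel transport between two points of the line through `y` and `x`. -/
noncomputable def transport (B : Fin d → Space d → A) (y x : Space d) (t s : ℝ) : A :=
  pexp B (seg y x t) (seg y x s)

@[fun_prop]
theorem Continuous.transport {B : Fin d → Space d → A} (hB : ∀ μ, Continuous (B μ))
    {X : Type*} [TopologicalSpace X] {f g : X → Space d} {h k : X → ℝ}
    (hf : Continuous f) (hg : Continuous g) (hh : Continuous h) (hk : Continuous k) :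
    Continuous fun a => transport B (f a) (g a) (h a) (k a) := by
  unfold HeatDiagram.transport
  fun_prop (disch := assumption)

theorem transport_eq {B : Fin d → Space d → A} (hB : ∀ μ, Continuous (B μ))
    (y x : Space d) (t s : ℝ) :
    transport B y x t s = 1 - ∫ r in s..t, tangential B y x r * transport B y x r s := by
  rw [transport, pexp_eq_one_sub_integral hB]
  have := intervalIntegral.smul_integral_comp_add_mul (a := 0) (b := 1)
    (fun r => tangential B y x r * transport B y x r s) (t - s) s
  simp only [mul_zero, add_zero, mul_one, add_sub_cancel] at this
  rw [← this, ← intervalIntegral.integral_smul]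
  simp only [tangential_seg, seg_seg, transport, smul_mul_assoc]

theorem transport_self {B : Fin d → Space d → A} (hB : ∀ μ, Continuous (B μ))
    (y x : Space d) (s : ℝ) : transport B y x s s = 1 := by
  rw [transport_eq hB]
  simp

theorem hasDerivAt_transport_left {B : Fin d → Space d → A} (hB : ∀ μ, Continuous (B μ))
    (y x : Space d) (t s : ℝ) :
    HasDerivAt (fun t => transport B y x t s)
      (-(tangential B y x t * transport B y x t s)) t := by
  have hc : Continuous fun r => tangential B y x r * transport B y x r s := by
    fun_prop (disch := assumption)
  have h := (hc.integral_hasStrictDerivAt s t).hasDerivAt.const_sub 1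
  refine h.congr_of_eventuallyEq (Filter.Eventually.of_forall fun t' => ?_)
  exact transport_eq hB y x t' s

/-- As functions of `t`, both sides solve the same linear ODE and agree at `t = r`. -/
theorem transport_mul {B : Fin d → Space d → A} (hB : ∀ μ, Continuous (B μ))
    (y x : Space d) (t r s : ℝ) :
    transport B y x t r * transport B y x r s = transport B y x t s := by
  have h := linear_ode_unique (b := tangential B y x) (t₀ := r)
    (f := fun t => transport B y x t r * transport B y x r s)
    (g := fun t => transport B y x t s) (by fun_prop (disch := assumption)) (fun t => ?_)
    (fun t => hasDerivAt_transport_left hB y x t s) (by simp [transport_self hB])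
  · exact congrFun h t
  · simpa [mul_assoc] using (hasDerivAt_transport_left hB y x t r).mul_const (transport B y x r s)

/-- The transport as a unit, with the inverse given by the transport in the opposite direction. -/
noncomputable def transportUnit {B : Fin d → Space d → A} (hB : ∀ μ, Continuous (B μ))
    (y x : Space d) (t s : ℝ) : Aˣ where
  val := transport B y x t s
  inv := transport B y x s t
  val_inv := by rw [transport_mul hB, transport_self hB]
  inv_val := by rw [transport_mul hB, transport_self hB]

theorem hasDerivAt_transport_right {B : Fin d → Space d → A} (hB : ∀ μ, Continuous (B μ))
    (y x : Space d) (t s : ℝ) :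
    HasDerivAt (fun s => transport B y x t s)
      (transport B y x t s * tangential B y x s) s := by
  -- The transport from `s` to `t` is the inverse of the one from `t` to `s`, whose derivative in
  -- `s` is known.
  have h := (hasFDerivAt_ringInverse (𝕜 := ℝ) (transportUnit hB y x s t)).comp_hasDerivAt s
    (hasDerivAt_transport_left hB y x s t)
  have e : (Ring.inverse ∘ fun s => transport B y x s t) = fun s => transport B y x t s := by
    funext s
    exact Ring.inverse_unit (transportUnit hB y x s t)
  rw [e] at h
  refine h.congr_deriv ?_
  change -(transport B y x t s * -(tangential B y x s * transport B y x s t)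
    * transport B y x t s) = _
  rw [mul_neg, neg_mul, neg_neg, mul_assoc, mul_assoc, transport_mul hB, transport_self hB,
    mul_one]

end Transport

/-! ### Parameter-dependent C¹ families and differentiation under the integral. -/

section Parametric

variable {E F A : Type*} [NormedAddCommGroup E] [NormedSpace ℝ E]
  [NormedAddCommGroup F] [NormedSpace ℝ F] [NormedRing A] [NormedAlgebra ℝ A]

/-- A function of a vector and a real parameter that is continuously differentiable in the vector,
locally uniformly in the parameter. -/
structure C1Param (f : E → ℝ → F) : Prop where
  continuous : Continuous fun p : E × ℝ => f p.1 p.2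
  differentiable : ∀ s, Differentiable ℝ fun x => f x s
  continuous_fderiv : Continuous fun p : E × ℝ => fderiv ℝ (fun x => f x p.2) p.1

theorem C1Param.mul {f g : E → ℝ → A} (hf : C1Param f) (hg : C1Param g) :
    C1Param fun x s => f x s * g x s where
  continuous := hf.continuous.mul hg.continuous
  differentiable s := (hf.differentiable s).mul (hg.differentiable s)
  continuous_fderiv := by
    have h : ∀ p : E × ℝ, fderiv ℝ (fun x => f x p.2 * g x p.2) p.1 =
        (ContinuousLinearMap.mul ℝ A (f p.1 p.2)).comp (fderiv ℝ (fun x => g x p.2) p.1) +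
        ((ContinuousLinearMap.mul ℝ A).flip (g p.1 p.2)).comp (fderiv ℝ (fun x => f x p.2) p.1) := by
      intro p
      rw [fderiv_fun_mul' (hf.differentiable _ _) (hg.differentiable _ _)]
      ext e
      simp
    simp only [h]
    have := hf.continuous
    have := hg.continuous
    have := hf.continuous_fderiv
    have := hg.continuous_fderiv
    fun_prop

theorem C1Param.of_contDiff {f : E → ℝ → F} (hf : ContDiff ℝ 1 fun p : E × ℝ => f p.1 p.2) :
    C1Param f := by
  have h : ∀ p : E × ℝ, HasFDerivAt (fun x => f x p.2)
      ((fderiv ℝ (fun p : E × ℝ => f p.1 p.2) p).comp (ContinuousLinearMap.inl ℝ E ℝ)) p.1 := by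
    intro p
    have h1 := (hf.differentiable one_ne_zero p).hasFDerivAt
    exact HasFDerivAt.comp (f := fun x => (x, p.2)) p.1 h1 (hasFDerivAt_prodMk_left p.1 p.2)
  refine ⟨hf.continuous, fun s x => (h (x, s)).differentiableAt, ?_⟩
  simp only [(h _).fderiv]
  have := hf.continuous_fderiv one_ne_zero
  fun_prop

theorem C1Param.hasFDerivAt_integral [ProperSpace E] {f : E → ℝ → F}
    (hf : C1Param f) (a b : ℝ) (x : E) :
    HasFDerivAt (fun x => ∫ s in a..b, f x s) (∫ s in a..b, fderiv ℝ (fun x => f x s) x) x := by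
  obtain ⟨K, hK⟩ := ((isCompact_closedBall x 1).prod (isCompact_uIcc (a := a) (b := b))).exists_bound_of_continuousOn
    hf.continuous_fderiv.continuousOn
  have hc : ∀ x, Continuous (f x) := fun x => hf.continuous.comp (Continuous.prodMk_right x)
  refine intervalIntegral.hasFDerivAt_integral_of_dominated_of_fderiv_le (bound := fun _ => K)
    (F' := fun x s => fderiv ℝ (fun x => f x s) x)
    (Metric.closedBall_mem_nhds x one_pos) ?_ ((hc x).intervalIntegrable _ _) ?_ ?_ ?_ ?_
  · exact Filter.Eventually.of_forall fun x => (hc x).aestronglyMeasurable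
  · exact (hf.continuous_fderiv.comp (Continuous.prodMk_right x)).aestronglyMeasurable
  · exact Filter.Eventually.of_forall fun s hs x' hx' => hK (x', s) ⟨hx', Set.uIoc_subset_uIcc hs⟩
  · simp
  · exact Filter.Eventually.of_forall fun s _ x' _ => (hf.differentiable s x').hasFDerivAt

theorem C1Param.contDiff_integral [ProperSpace E] {f : E → ℝ → F}
    (hf : C1Param f) (a b : ℝ) : ContDiff ℝ 1 fun x => ∫ s in a..b, f x s := by
  rw [contDiff_one_iff_fderiv]
  refine ⟨fun x => (hf.hasFDerivAt_integral a b x).differentiableAt, ?_⟩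
  rw [show fderiv ℝ (fun x => ∫ s in a..b, f x s) =
    fun x => ∫ s in a..b, fderiv ℝ (fun x => f x s) x from
      funext fun x => (hf.hasFDerivAt_integral a b x).fderiv]
  exact intervalIntegral.continuous_parametric_intervalIntegral_of_continuous'
    hf.continuous_fderiv _ _

theorem C1Param.fderiv_integral_apply [ProperSpace E] [CompleteSpace F] {f : E → ℝ → F}
    (hf : C1Param f) (a b : ℝ) (x e : E) :
    fderiv ℝ (fun x => ∫ s in a..b, f x s) x e =
      ∫ s in a..b, fderiv ℝ (fun x => f x s) x e := by
  rw [(hf.hasFDerivAt_integral a b x).fderiv, ContinuousLinearMap.intervalIntegral_apply]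
  exact (hf.continuous_fderiv.comp (Continuous.prodMk_right x)).intervalIntegrable _ _

/-- Hadamard's lemma: `G` is the mean of the derivative over the segment from `x` to `x'`. Its joint
continuity is what the derivative of the transport needs. -/
theorem C1Param.exists_sub_eq_apply [CompleteSpace F] {f : E → ℝ → F} (hf : C1Param f) :
    ∃ G : E → E → ℝ → E →L[ℝ] F, (Continuous fun p : E × E × ℝ => G p.1 p.2.1 p.2.2) ∧
      (∀ x' x t, f x' t - f x t = G x' x t (x' - x)) ∧
      ∀ x t, G x x t = fderiv ℝ (fun x => f x t) x := by
  refine ⟨fun x' x t => ∫ θ in (0 : ℝ)..1, fderiv ℝ (fun x => f x t) (x + θ • (x' - x)),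
    ?_, fun x' x t => ?_, fun x t => by simp⟩
  · refine intervalIntegral.continuous_parametric_intervalIntegral_of_continuous' ?_ _ _
    exact hf.continuous_fderiv.comp
      (f := fun q : (E × E × ℝ) × ℝ => (q.1.2.1 + q.2 • (q.1.1 - q.1.2.1), q.1.2.2)) (by fun_prop)
  · have hc : Continuous fun θ : ℝ => fderiv ℝ (fun x => f x t) (x + θ • (x' - x)) :=
      hf.continuous_fderiv.comp (f := fun θ : ℝ => (x + θ • (x' - x), t)) (by fun_prop)
    rw [ContinuousLinearMap.intervalIntegral_apply (hc.intervalIntegrable _ _)]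
    rw [intervalIntegral.integral_eq_sub_of_hasDerivAt (f := fun θ : ℝ => f (x + θ • (x' - x)) t)]
    · simp
    · intro θ _
      have h1 : HasDerivAt (fun θ : ℝ => x + θ • (x' - x)) (x' - x) θ := by
        simpa using ((hasDerivAt_id θ).smul_const (x' - x)).const_add x
      exact ((hf.differentiable t _).hasFDerivAt).comp_hasDerivAt θ h1
    · exact (hc.clm_apply continuous_const).intervalIntegrable _ _

/-- Carathéodory's criterion for differentiability. -/
theorem hasFDerivAt_of_sub_eq_apply {f : E → F} {M : E → E →L[ℝ] F} {x : E}
    (h : ∀ x', f x' - f x = M x' (x' - x)) (hM : ContinuousAt M x) : HasFDerivAt f (M x) x := by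
  rw [hasFDerivAt_iff_isLittleO]
  have h1 : ∀ x', f x' - f x - M x (x' - x) = (M x' - M x) (x' - x) := fun x' => by
    rw [h, sub_apply]
  simp only [h1]
  have h2 : (fun x' => M x' - M x) =o[nhds x] fun _ => (1 : ℝ) := by
    rw [Asymptotics.isLittleO_one_iff]
    simpa using (hM.tendsto.sub_const (M x))
  have h3 := h2.norm_left.mul_isBigO (Asymptotics.isBigO_refl (fun x' => ‖x' - x‖) (nhds x))
  refine Asymptotics.IsBigO.trans_isLittleO (g := fun x' => ‖M x' - M x‖ * ‖x' - x‖) ?_ ?_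
  · exact Asymptotics.isBigO_of_le _ fun x' => by
      simpa using (M x' - M x).le_opNorm (x' - x)
  · simpa using h3.norm_right

end Parametric

/-! ### The derivative of the transport with respect to its endpoint. -/

section TransportDerivative

variable {d : ℕ} {A : Type*} [NormedRing A] [NormedAlgebra ℝ A]

theorem contDiff_tangential {B : Fin d → Space d → A} (hB : ∀ μ, ContDiff ℝ ∞ (B μ))
    (y : Space d) : ContDiff ℝ ∞ fun p : Space d × ℝ => tangential B y p.1 p.2 := by
  unfold tangential
  refine ContDiff.sum fun ν _ => ?_
  have h1 : ContDiff ℝ ∞ fun p : Space d × ℝ => seg y p.1 p.2 := by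
    unfold seg
    fun_prop
  have h2 := (hB ν).comp h1
  have h3 : ContDiff ℝ ∞ fun p : Space d × ℝ => p.1 ν - y ν := by fun_prop
  exact h3.smul h2

theorem hasFDerivAt_seg (y x : Space d) (t : ℝ) :
    HasFDerivAt (fun x => seg y x t) (t • ContinuousLinearMap.id ℝ (Space d)) x := by
  unfold seg
  exact ((hasFDerivAt_id x).const_smul t).const_add _

theorem hasDerivAt_seg (y x : Space d) (t : ℝ) : HasDerivAt (fun t => seg y x t) (x - y) t := by
  unfold seg
  have h := (((hasDerivAt_id t).const_sub 1).smul_const y).add ((hasDerivAt_id t).smul_const x)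
  refine h.congr_deriv ?_
  simp
  abel

theorem pd_comp_seg {f : Space d → A} {y x : Space d} {t : ℝ} (ρ : Fin d)
    (hf : DifferentiableAt ℝ f (seg y x t)) :
    pd ρ (fun x => f (seg y x t)) x = t • pd ρ f (seg y x t) := by
  have h := HasFDerivAt.comp x hf.hasFDerivAt (hasFDerivAt_seg y x t)
  unfold pd
  rw [show (fun x => f (seg y x t)) = f ∘ fun x => seg y x t from rfl, h.fderiv]
  simp

theorem pd_mul {f g : Space d → A} {x : Space d} (ρ : Fin d)
    (hf : DifferentiableAt ℝ f x) (hg : DifferentiableAt ℝ g x) :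
    pd ρ (fun x => f x * g x) x = pd ρ f x * g x + f x * pd ρ g x := by
  unfold pd
  rw [fderiv_fun_mul' hf hg]
  simp [add_comm]

theorem fderiv_apply_eq_sum_pd (f : Space d → A) (x h : Space d) :
    fderiv ℝ f x h = ∑ ν, h ν • pd ν f x := by
  have e : h = ∑ ν, h ν • EuclideanSpace.single ν (1 : ℝ) := by
    ext i
    simp [Finset.sum_apply, Pi.single_apply]
  conv_lhs => rw [e]
  simp [pd]

theorem pd_tangential {B : Fin d → Space d → A} (hB : ∀ μ, Differentiable ℝ (B μ))
    (y x : Space d) (t : ℝ) (ρ : Fin d) :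
    pd ρ (fun x => tangential B y x t) x =
      B ρ (seg y x t) + t • ∑ ν, (x ν - y ν) • pd ρ (B ν) (seg y x t) := by
  unfold tangential
  have h : ∀ ν, HasFDerivAt (fun x : Space d => (x ν - y ν) • B ν (seg y x t))
      ((x ν - y ν) • (fderiv ℝ (B ν) (seg y x t)).comp (t • ContinuousLinearMap.id ℝ (Space d)) +
        (EuclideanSpace.proj ν : Space d →L[ℝ] ℝ).smulRight (B ν (seg y x t))) x := fun ν =>
    HasFDerivAt.fun_smul ((EuclideanSpace.proj ν : Space d →L[ℝ] ℝ).hasFDerivAt.sub_const (y ν))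
      (HasFDerivAt.comp x ((hB ν _).hasFDerivAt) (hasFDerivAt_seg y x t))
  unfold pd
  rw [(HasFDerivAt.fun_sum fun ν _ => h ν).fderiv]
  simp [Finset.sum_add_distrib, Finset.smul_sum, add_comm, smul_comm t]

theorem transport_one (B : Fin d → Space d → A) (y x : Space d) (s : ℝ) :
    transport B y x 1 s = pexp B x (seg y x s) := by rw [transport, seg_one]

theorem transport_one_zero (B : Fin d → Space d → A) (y x : Space d) :
    transport B y x 1 0 = pexp B x y := by rw [transport_one, seg_zero]

variable [CompleteSpace A]

/-- Duhamel's formula: differentiate in `t` the product of the `x'`-transport from `t` to `1` and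
the `x`-transport from `s` to `t`. -/
theorem transport_sub_transport {B : Fin d → Space d → A} (hB : ∀ μ, Continuous (B μ))
    (y x x' : Space d) (s : ℝ) :
    transport B y x' 1 s - transport B y x 1 s =
      ∫ t in (1 : ℝ)..s, transport B y x' 1 t * (tangential B y x' t - tangential B y x t) *
        transport B y x t s := by
  rw [intervalIntegral.integral_eq_sub_of_hasDerivAt
    (f := fun t => transport B y x' 1 t * transport B y x t s)]
  · simp [transport_self hB]
  · intro t _
    refine ((hasDerivAt_transport_right hB y x' 1 t).mul
      (hasDerivAt_transport_left hB y x t s)).congr_deriv ?_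
    noncomm_ring
  · refine Continuous.intervalIntegrable ?_ _ _
    fun_prop (disch := assumption)

/-- Inserting Hadamard's lemma into Duhamel's formula writes the increment as a continuous operator
`M` applied to `x' - x`; its value on the diagonal is the derivative. -/
theorem transport_fderiv {B : Fin d → Space d → A} (hB : ∀ μ, ContDiff ℝ ∞ (B μ)) (y : Space d) :
    C1Param (fun x s => transport B y x 1 s) ∧
    ∀ x s e, fderiv ℝ (fun x => transport B y x 1 s) x e =
      ∫ t in (1 : ℝ)..s, transport B y x 1 t * fderiv ℝ (fun x => tangential B y x t) x e *
        transport B y x t s := by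
  have hB' : ∀ μ, Continuous (B μ) := fun μ => (hB μ).continuous
  have hT : C1Param (tangential B y) :=
    C1Param.of_contDiff ((contDiff_tangential hB y).of_le (by simp))
  obtain ⟨G, hG, hsub, hdiag⟩ := hT.exists_sub_eq_apply
  let I : Space d × Space d × ℝ → ℝ → (Space d →L[ℝ] A) := fun p t =>
    (ContinuousLinearMap.mulLeftRight ℝ A (transport B y p.1 1 t)
      (transport B y p.2.1 t p.2.2)).comp (G p.1 p.2.1 t)
  have hI : Continuous fun q : (Space d × Space d × ℝ) × ℝ => I q.1 q.2 := by
    have h1 : Continuous fun q : (Space d × Space d × ℝ) × ℝ => G q.1.1 q.1.2.1 q.2 :=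
      hG.comp (f := fun q : (Space d × Space d × ℝ) × ℝ => (q.1.1, q.1.2.1, q.2)) (by fun_prop)
    have h2 : Continuous fun q : (Space d × Space d × ℝ) × ℝ => transport B y q.1.1 1 q.2 := by
      fun_prop (disch := assumption)
    have h3 : Continuous fun q : (Space d × Space d × ℝ) × ℝ =>
        transport B y q.1.2.1 q.2 q.1.2.2 := by
      fun_prop (disch := assumption)
    simp only [I]
    fun_prop
  let M : Space d × Space d × ℝ → (Space d →L[ℝ] A) := fun p => ∫ t in (1 : ℝ)..p.2.2, I p t
  have hM : Continuous M :=
    intervalIntegral.continuous_parametric_intervalIntegral_of_continuous hI (by fun_prop)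
  have hMapply : ∀ p e, M p e = ∫ t in (1 : ℝ)..p.2.2, I p t e := fun p e =>
    ContinuousLinearMap.intervalIntegral_apply
      ((hI.comp (Continuous.prodMk_right p)).intervalIntegrable _ _) e
  have hD : ∀ s x, HasFDerivAt (fun x => transport B y x 1 s) (M (x, x, s)) x := by
    intro s x
    refine hasFDerivAt_of_sub_eq_apply (M := fun x' => M (x', x, s)) (fun x' => ?_)
      (hM.comp (f := fun x' => (x', x, s)) (by fun_prop)).continuousAt
    rw [transport_sub_transport hB', hMapply]
    simp only [I, hsub, ContinuousLinearMap.comp_apply, ContinuousLinearMap.mulLeftRight_apply]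
  refine ⟨⟨by fun_prop (disch := assumption), fun s x => (hD s x).differentiableAt, ?_⟩, ?_⟩
  · simp only [(hD _ _).fderiv]
    fun_prop
  · intro x s e
    rw [(hD s x).fderiv, hMapply]
    simp only [I, hdiag, ContinuousLinearMap.comp_apply, ContinuousLinearMap.mulLeftRight_apply]

/-- The covariant derivative of a transport is an integral of the field strength. -/
theorem covariant_pd_transport {B : Fin d → Space d → A} (hB : ∀ μ, ContDiff ℝ ∞ (B μ))
    (y x : Space d) (s : ℝ) (ρ : Fin d) :
    pd ρ (fun x => transport B y x 1 s) x + B ρ x * transport B y x 1 s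
        - s • (transport B y x 1 s * B ρ (seg y x s)) =
      ∫ t in s..1, transport B y x 1 t *
        (t • ∑ ν, (x ν - y ν) • fieldStrength B ν ρ (seg y x t)) * transport B y x t s := by
  have hB' : ∀ μ, Continuous (B μ) := fun μ => (hB μ).continuous
  have hB'' : ∀ μ, Differentiable ℝ (B μ) := fun μ => (hB μ).differentiable (by simp)
  have hpd : ∀ μ ν, Continuous (pd μ (B ν)) := fun μ ν =>
    ((hB ν).continuous_fderiv (by simp)).clm_apply continuous_const
  -- The two boundary terms are the values at `t = 1` and `t = s` of `t` times the transport with `B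
  -- ρ` inserted at parameter `t`.
  have hboundary : B ρ x * transport B y x 1 s - s • (transport B y x 1 s * B ρ (seg y x s)) =
      ∫ t in s..1, (transport B y x 1 t * B ρ (seg y x t) * transport B y x t s +
        t • (transport B y x 1 t * (tangential B y x t * B ρ (seg y x t) +
          ∑ ν, (x ν - y ν) • pd ν (B ρ) (seg y x t) - B ρ (seg y x t) * tangential B y x t) *
            transport B y x t s)) := by
    rw [intervalIntegral.integral_eq_sub_of_hasDerivAt
      (f := fun t => t • (transport B y x 1 t * B ρ (seg y x t) * transport B y x t s))]
    · simp [transport_self hB', seg_one]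
    · intro t _
      have h1 : HasDerivAt (fun t => B ρ (seg y x t))
          (∑ ν, (x ν - y ν) • pd ν (B ρ) (seg y x t)) t := by
        refine ((hB'' ρ _).hasFDerivAt.comp_hasDerivAt t (hasDerivAt_seg y x t)).congr_deriv ?_
        rw [fderiv_apply_eq_sum_pd]
        simp
      have h2 := ((hasDerivAt_transport_right hB' y x 1 t).mul h1).mul
        (hasDerivAt_transport_left hB' y x t s)
      refine ((hasDerivAt_id t).smul h2).congr_deriv ?_
      simp only [id, one_smul, Pi.mul_apply]
      rw [add_comm]
      congr 2
      noncomm_ring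
    · refine Continuous.intervalIntegrable ?_ _ _
      have := hB' ρ
      have := hpd
      fun_prop (disch := assumption)
  have hpdt : pd ρ (fun x => transport B y x 1 s) x = -∫ t in s..1, transport B y x 1 t *
      (B ρ (seg y x t) + t • ∑ ν, (x ν - y ν) • pd ρ (B ν) (seg y x t)) * transport B y x t s := by
    rw [pd, (transport_fderiv hB y).2, intervalIntegral.integral_symm]
    have := pd_tangential hB'' y x (ρ := ρ)
    simp only [pd] at this
    simp only [this, pd]
  rw [add_sub_assoc, hboundary, hpdt, neg_add_eq_sub, ← intervalIntegral.integral_sub]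
  · refine intervalIntegral.integral_congr fun t _ => ?_
    -- The undifferentiated insertions of `B ρ` without a factor `t` cancel; the terms with factor
    -- `t` assemble into the field strength.
    have hF : ∑ ν, (x ν - y ν) • fieldStrength B ν ρ (seg y x t) =
        ∑ ν, (x ν - y ν) • pd ν (B ρ) (seg y x t) - ∑ ν, (x ν - y ν) • pd ρ (B ν) (seg y x t) +
        (tangential B y x t * B ρ (seg y x t) - B ρ (seg y x t) * tangential B y x t) := by
      simp only [fieldStrength, tangential, smul_add, smul_sub, Finset.sum_add_distrib,
        Finset.sum_sub_distrib, Finset.sum_mul, Finset.mul_sum, smul_mul_assoc, mul_smul_comm]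
    simp only [hF, mul_smul_comm, smul_mul_assoc, smul_sub, smul_add, mul_add, add_mul, mul_sub,
      sub_mul]
    abel
  all_goals
    refine Continuous.intervalIntegrable ?_ _ _
    have := hB' ρ
    have := hpd
    fun_prop (disch := assumption)

end TransportDerivative

/-! ### Integrals insensitive to the value at zero, and an exchange of integrals. -/

section Integrals

theorem intervalIntegrable_of_eq_of_ne_zero {F : Type*} [NormedAddCommGroup F] {f g : ℝ → F} {b : ℝ}
    (hg : Continuous g)
    (h : ∀ s ≠ 0, f s = g s) : IntervalIntegrable f MeasureTheory.volume 0 b := by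
  refine (hg.intervalIntegrable 0 b).congr_ae ?_
  refine MeasureTheory.ae_restrict_of_ae ?_
  filter_upwards [MeasureTheory.Measure.ae_ne MeasureTheory.volume (0 : ℝ)] with s hs
  exact (h s hs).symm

variable {A : Type*} [NormedRing A] [NormedAlgebra ℝ A]

theorem integral_congr_of_ne_zero {f g : ℝ → A} {b : ℝ}
    (h : ∀ s ≠ 0, f s = g s) : ∫ s in (0 : ℝ)..b, f s = ∫ s in (0 : ℝ)..b, g s := by
  refine intervalIntegral.integral_congr_ae ?_
  filter_upwards [MeasureTheory.Measure.ae_ne MeasureTheory.volume (0 : ℝ)] with s hs _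
  exact h s hs

theorem integral_mul_left_of_continuous [CompleteSpace A] {f : ℝ → A} (hf : Continuous f)
    (a : A) (b c : ℝ) : ∫ s in b..c, a * f s = a * ∫ s in b..c, f s :=
  (ContinuousLinearMap.mul ℝ A a).intervalIntegral_comp_comm (hf.intervalIntegrable b c)

theorem integral_mul_right_of_continuous [CompleteSpace A] {f : ℝ → A} (hf : Continuous f)
    (a : A) (b c : ℝ) : ∫ s in b..c, f s * a = (∫ s in b..c, f s) * a :=
  ((ContinuousLinearMap.mul ℝ A).flip a).intervalIntegral_comp_comm (hf.intervalIntegrable b c)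

/-- Fubini on a triangle, obtained by integrating by parts: one primitive vanishes at `1`, the other
at `0`. -/
theorem integral_integral_mul_swap [CompleteSpace A] {p q : ℝ → A} (hp : Continuous p)
    (hq : Continuous q) :
    ∫ s in (0 : ℝ)..1, (∫ t in s..1, p t) * q s = ∫ t in (0 : ℝ)..1, p t * ∫ s in (0 : ℝ)..t, q s := by
  have hu : ∀ s, HasDerivAt (fun s => ∫ t in s..1, p t) (-p s) s := by
    intro s
    simp only [intervalIntegral.integral_symm 1]
    exact (hp.integral_hasStrictDerivAt 1 s).hasDerivAt.neg
  have hv : ∀ s, HasDerivAt (fun s => ∫ t in (0 : ℝ)..s, q t) (q s) s := fun s =>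
    (hq.integral_hasStrictDerivAt 0 s).hasDerivAt
  rw [intervalIntegral.integral_mul_deriv_eq_deriv_mul (fun s _ => hu s) (fun s _ => hv s)
    (hp.neg.intervalIntegrable _ _) (hq.intervalIntegrable _ _)]
  simp

end Integrals

/-! ### Smoothness, scaling and covariant derivatives of the vertex forms. -/

section Forms

variable {d : ℕ} {A : Type*} [NormedRing A] [NormedAlgebra ℝ A]

theorem contDiff_pd {f : Space d → A} (hf : ContDiff ℝ ∞ f) (μ : Fin d) :
    ContDiff ℝ ∞ (pd μ f) :=
  (hf.fderiv_right (m := ∞) (by simp)).clm_apply contDiff_const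

theorem contDiff_nabla {B : Fin d → Space d → A} (hB : ∀ μ, ContDiff ℝ ∞ (B μ)) {f : Space d → A}
    (hf : ContDiff ℝ ∞ f) (μ : Fin d) : ContDiff ℝ ∞ (nabla B μ f) :=
  (contDiff_pd hf μ).add (((hB μ).mul hf).sub (hf.mul (hB μ)))

theorem contDiff_fieldStrength {B : Fin d → Space d → A} (hB : ∀ μ, ContDiff ℝ ∞ (B μ))
    (ν μ : Fin d) : ContDiff ℝ ∞ (fieldStrength B ν μ) :=
  ((contDiff_pd (hB μ) ν).sub (contDiff_pd (hB ν) μ)).add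
    (((hB ν).mul (hB μ)).sub ((hB μ).mul (hB ν)))

theorem contDiff_circleForm {B : Fin d → Space d → A} (hB : ∀ μ, ContDiff ℝ ∞ (B μ)) (y : Space d)
    (s : ℝ) (μs : List (Fin d)) (μ : Fin d) : ContDiff ℝ ∞ (circleForm B y s μs μ) := by
  induction μs with
  | nil =>
    refine ContDiff.sum fun ν _ => ?_
    have h : ContDiff ℝ ∞ fun z : Space d => s⁻¹ * (z ν - y ν) := by fun_prop
    exact h.smul (contDiff_fieldStrength hB ν μ)
  | cons μ₁ μs ih => exact contDiff_nabla hB ih μ₁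

theorem nabla_smul (B : Fin d → Space d → A) (c : ℝ) (f : Space d → A) (μ : Fin d) (z : Space d) :
    nabla B μ (fun z => c • f z) z = c • nabla B μ f z := by
  have h : pd μ (fun z => c • f z) z = c • pd μ f z := by
    unfold pd
    rw [show (fun z => c • f z) = c • f from rfl, fderiv_const_smul_field]
    rfl
  simp only [nabla, h, smul_add, smul_sub, mul_smul_comm, smul_mul_assoc]

theorem circleForm_eq_inv_smul (B : Fin d → Space d → A) (y : Space d) (s : ℝ)
    (μs : List (Fin d)) (μ : Fin d) :
    circleForm B y s μs μ = fun z => s⁻¹ • circleForm B y 1 μs μ z := by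
  induction μs with
  | nil =>
    funext z
    simp [circleForm, Finset.smul_sum, smul_smul]
  | cons μ₁ μs ih =>
    funext z
    simp only [circleForm]
    rw [ih, nabla_smul]

theorem circleForm_nil_seg (B : Fin d → Space d → A) (y x : Space d) {s : ℝ} (hs : s ≠ 0)
    (μ : Fin d) : circleForm B y s [] μ (seg y x s) =
      ∑ ν, (x ν - y ν) • fieldStrength B ν μ (seg y x s) := by
  simp only [circleForm, seg_sub_apply]
  exact Finset.sum_congr rfl fun ν _ => by rw [inv_mul_cancel_left₀ hs]

namespace Vertex

theorem contDiff_form {B : Fin d → Space d → A} (hB : ∀ μ, ContDiff ℝ ∞ (B μ)) (y : Space d)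
    (s : ℝ) (v : Vertex d) : ContDiff ℝ ∞ (v.form B y s) := by
  obtain ⟨_ | ⟨μs, μ⟩, k⟩ := v
  · exact (contDiff_circleForm hB y s _ _).const_smul _
  · exact contDiff_const

/-- The factor `t` on the left is the Jacobian of `s = t * u`. Both kinds of vertex depend on the
parameter only through the power of the weight times an inverse. -/
theorem smul_form_mul (B : Fin d → Space d → A) (y : Space d) (v : Vertex d) {t : ℝ} (ht : t ≠ 0)
    (u : ℝ) (z : Space d) : t • v.form B y (t * u) z = t ^ v.power • v.form B y u z := by
  obtain ⟨_ | ⟨μs, μ⟩, k⟩ := v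
  · simp only [form]
    rw [circleForm_eq_inv_smul B y (t * u), circleForm_eq_inv_smul B y u]
    simp only [smul_smul]
    congr 1
    field_simp
    rw [mul_pow]
  · simp only [form, smul_smul]
    congr 1
    field_simp
    rw [mul_pow]

theorem form_raise (B : Fin d → Space d → A) (y : Space d) (v : Vertex d) (s : ℝ) (z : Space d) :
    v.raise.form B y s z = s • v.form B y s z := by
  obtain ⟨_ | ⟨μs, μ⟩, k⟩ := v <;> simp only [form, raise, smul_smul] <;> congr 1 <;> ring

theorem form_attach (B : Fin d → Space d → A) (y : Space d) (ρ : Fin d) {v : Vertex d}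
    (hv : v.isCircle = true) (s : ℝ) (z : Space d) :
    (v.attach ρ).form B y s z = s • nabla B ρ (v.form B y s) z := by
  obtain ⟨_ | ⟨μs, μ⟩, k⟩ := v
  · simp only [form, attach, circleForm]
    rw [nabla_smul, smul_smul, pow_succ']
  · simp [isCircle] at hv

theorem nabla_form_of_cross (B : Fin d → Space d → A) (y : Space d) (ρ : Fin d) {v : Vertex d}
    (hv : v.isCircle = false) (s : ℝ) (z : Space d) : nabla B ρ (v.form B y s) z = 0 := by
  obtain ⟨_ | ⟨μs, μ⟩, k⟩ := v
  · simp [isCircle] at hv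
  · simp [form, nabla, pd]

theorem Admissible.raise {v : Vertex d} (hv : v.Admissible) : v.raise.Admissible := by
  obtain ⟨⟨_ | ⟨_, _⟩, _⟩ | _, k⟩ := v <;> simp [Vertex.Admissible, Vertex.raise]

theorem Admissible.attach (ρ : Fin d) {v : Vertex d} (hv : v.Admissible) :
    (v.attach ρ).Admissible := by
  obtain ⟨_ | _, k⟩ := v
  · simp [Vertex.Admissible, Vertex.attach]
  · exact hv

/-- The singular `s⁻¹` is cancelled by a positive power or, for a circle with one index, by `z - y =
s (x - y)`. Only `s = 0` is lost, where the inverse takes its default value. -/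
theorem Admissible.exists_c1Param {B : Fin d → Space d → A} (hB : ∀ μ, ContDiff ℝ ∞ (B μ))
    (y : Space d) {v : Vertex d} (hv : v.Admissible) :
    ∃ g : Space d → ℝ → A, C1Param g ∧ ∀ x, ∀ s ≠ 0, v.form B y s (seg y x s) = g x s := by
  have hseg : ContDiff ℝ 1 fun p : Space d × ℝ => seg y p.1 p.2 := by
    unfold seg
    fun_prop
  have hpow : ∀ k, 1 ≤ k → ∀ s : ℝ, s ≠ 0 → s ^ k * s⁻¹ = s ^ (k - 1) := by
    intro k hk s hs
    obtain ⟨k, rfl⟩ := Nat.exists_eq_add_of_le' hk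
    rw [pow_succ, mul_inv_cancel_right₀ hs, Nat.add_sub_cancel]
  obtain ⟨⟨_ | ⟨μ₁, μs⟩, μ⟩ | _, k⟩ := v
  · refine ⟨fun x s => s ^ k • ∑ ν, (x ν - y ν) • fieldStrength B ν μ (seg y x s),
      C1Param.of_contDiff ?_, fun x s hs => ?_⟩
    · have h1 : ContDiff ℝ 1 fun p : Space d × ℝ => p.2 ^ k := by fun_prop
      refine h1.smul (ContDiff.sum fun ν _ => ?_)
      have h2 : ContDiff ℝ 1 fun p : Space d × ℝ => p.1 ν - y ν := by fun_prop
      exact h2.smul (((contDiff_fieldStrength hB ν μ).of_le (by simp)).comp hseg)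
    · simp only [form]
      rw [circleForm_nil_seg B y x hs]
  · refine ⟨fun x s => s ^ (k - 1) • circleForm B y 1 (μ₁ :: μs) μ (seg y x s),
      C1Param.of_contDiff ?_, fun x s hs => ?_⟩
    · have h1 : ContDiff ℝ 1 fun p : Space d × ℝ => p.2 ^ (k - 1) := by fun_prop
      exact h1.smul (((contDiff_circleForm hB y 1 (μ₁ :: μs) μ).of_le (by simp)).comp hseg)
    · simp only [form]
      rw [circleForm_eq_inv_smul, smul_smul, hpow k hv s hs]
  · refine ⟨fun x s => s ^ (k - 1) • 1, C1Param.of_contDiff (by fun_prop), fun x s hs => ?_⟩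
    simp only [form]
    rw [hpow k hv s hs]

/-- For a circle the expression is the form of the vertex with `ρ` attached, which is again
admissible. -/
theorem Admissible.exists_nabla_continuous {B : Fin d → Space d → A}
    (hB : ∀ μ, ContDiff ℝ ∞ (B μ)) (y : Space d) (ρ : Fin d) {v : Vertex d} (hv : v.Admissible)
    (x : Space d) :
    ∃ g : ℝ → A, Continuous g ∧ ∀ s ≠ 0, s • nabla B ρ (v.form B y s) (seg y x s) = g s := by
  cases hc : v.isCircle
  · exact ⟨fun _ => 0, continuous_const, fun s _ => by rw [nabla_form_of_cross _ _ _ hc, smul_zero]⟩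
  · obtain ⟨g, hg, h⟩ := (hv.attach ρ).exists_c1Param hB y
    exact ⟨g x, hg.continuous.comp (Continuous.prodMk_right x), fun s hs => by
      rw [← form_attach _ _ _ hc, h x s hs]⟩

end Vertex

end Forms

/-! ### Derivatives of diagrams. -/

namespace Diagram

variable {d : ℕ}

theorem Admissible.diffLine {D : Diagram d} (hD : D.Admissible) (ρ : Fin d) (l : ℕ) :
    (D.diffLine ρ l).Admissible := by
  intro v hv
  simp only [Diagram.diffLine, List.mem_append, List.mem_map, List.mem_cons] at hv
  obtain ⟨w, hw, rfl⟩ | rfl | hv := hv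
  · exact (hD w (List.mem_of_mem_take hw)).raise
  · trivial
  · exact hD v (List.mem_of_mem_drop hv)

theorem Admissible.diffCircle {D : Diagram d} (hD : D.Admissible) (ρ : Fin d) (c : Fin D.length) :
    (D.diffCircle ρ c).Admissible := by
  intro v hv
  simp only [Diagram.diffCircle, List.mem_append, List.mem_map, List.mem_cons] at hv
  obtain ⟨w, hw, rfl⟩ | rfl | hv := hv
  · exact (hD w (List.mem_of_mem_take hw)).raise
  · exact (hD _ (List.get_mem _ _)).attach ρ
  · exact hD v (List.mem_of_mem_drop hv)

theorem length_derivative (ρ : Fin d) (D : Diagram d) :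
    (D.derivative ρ).length = D.numLines + D.numCircles := by
  have h : D.numCircles = ((List.finRange D.length).map D.get).countP Vertex.isCircle := by
    rw [List.map_get_finRange]
    rfl
  rw [h, List.countP_map, List.countP_eq_length_filter]
  simp only [derivative, List.length_append, List.length_map, List.length_range]
  rfl

theorem Admissible.derivative {D : Diagram d} (hD : D.Admissible) (ρ : Fin d) :
    ∀ D' ∈ D.derivative ρ, D'.Admissible := by
  intro D' hD'
  simp only [Diagram.derivative, List.mem_append, List.mem_map] at hD'
  obtain ⟨l, _, rfl⟩ | ⟨c, _, rfl⟩ := hD'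
  · exact hD.diffLine ρ l
  · exact hD.diffCircle ρ c

variable {A : Type*} [NormedRing A] [NormedAlgebra ℝ A]

theorem value_cons (B : Fin d → Space d → A) (v : Vertex d) (D : Diagram d) (x y : Space d) :
    value B (v :: D) x y = ∫ s in (0 : ℝ)..1,
      pexp B x (seg y x s) * v.form B y s (seg y x s) * value B D (seg y x s) y := rfl

/-- Substituting `s = t * u` rescales only the first vertex: the later ones are parameterized
relative to it. -/
theorem pow_smul_value_cons_seg {B : Fin d → Space d → A}
    (y x : Space d) (v : Vertex d) (D : Diagram d) {t : ℝ} (ht : t ≠ 0) :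
    t ^ v.power • value B (v :: D) (seg y x t) y = ∫ s in (0 : ℝ)..t,
      transport B y x t s * v.form B y s (seg y x s) * value B D (seg y x s) y := by
  have h := intervalIntegral.smul_integral_comp_mul_left (a := 0) (b := 1)
    (fun s => transport B y x t s * v.form B y s (seg y x s) * value B D (seg y x s) y) t
  rw [mul_zero, mul_one] at h
  rw [← h, value_cons, ← intervalIntegral.integral_smul, ← intervalIntegral.integral_smul]
  refine intervalIntegral.integral_congr fun u _ => ?_
  simp only [seg_seg_right, transport]
  rw [← smul_mul_assoc, ← mul_smul_comm, ← smul_mul_assoc, ← mul_smul_comm,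
    Vertex.smul_form_mul B y v ht]

theorem actVertex_eq_value_diffCircle (B : Fin d → Space d → A) (y : Space d) (ρ : Fin d)
    {D : Diagram d} (c : Fin D.length) (hc : (D.get c).isCircle = true) (x : Space d) :
    D.actVertex B ρ c x y = (D.diffCircle ρ c).value B x y := by
  induction D generalizing x with
  | nil => exact c.elim0
  | cons v D ih =>
    cases c using Fin.cases with
    | zero =>
      refine intervalIntegral.integral_congr fun s _ => ?_
      rw [← Vertex.form_attach B y ρ (v := v) hc]
      rfl
    | succ c =>
      change _ = value B (v.raise :: diffCircle ρ D c) x y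
      rw [value_cons]
      refine intervalIntegral.integral_congr fun s _ => ?_
      rw [ih c hc, Vertex.form_raise, mul_smul_comm, mul_smul_comm, smul_mul_assoc]

theorem actVertex_eq_zero (B : Fin d → Space d → A) (y : Space d) (ρ : Fin d)
    {D : Diagram d} (c : Fin D.length) (hc : (D.get c).isCircle = false) (x : Space d) :
    D.actVertex B ρ c x y = 0 := by
  induction D generalizing x with
  | nil => exact c.elim0
  | cons v D ih =>
    cases c using Fin.cases with
    | zero =>
      have h : ∀ s, nabla B ρ (v.form B y s) (seg y x s) = 0 := fun s =>
        Vertex.nabla_form_of_cross B y ρ hc s _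
      simp [actVertex, h]
    | succ c =>
      have h := ih c hc
      simp [actVertex, h]

variable [CompleteSpace A]

theorem c1Param_integrand {B : Fin d → Space d → A} (hB : ∀ μ, ContDiff ℝ ∞ (B μ)) (y : Space d)
    {g : Space d → ℝ → A} (hg : C1Param g) {V : Space d → A} (hV : ContDiff ℝ 1 V) :
    C1Param fun x s => pexp B x (seg y x s) * g x s * V (seg y x s) := by
  have h1 := (transport_fderiv hB y).1
  simp only [transport_one] at h1
  refine (h1.mul hg).mul (C1Param.of_contDiff (hV.comp ?_))
  unfold seg
  fun_prop

theorem contDiff_value {B : Fin d → Space d → A} (hB : ∀ μ, ContDiff ℝ ∞ (B μ)) (y : Space d)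
    {D : Diagram d} (hD : D.Admissible) : ContDiff ℝ 1 fun x => value B D x y := by
  induction D with
  | nil =>
    have h1 := (transport_fderiv hB y).1
    -- A family constant in the parameter is its own integral over the unit interval, so the result
    -- on parametric integrals applies.
    have h2 : C1Param fun (x : Space d) (_ : ℝ) => transport B y x 1 0 :=
      ⟨h1.continuous.comp (f := fun p : Space d × ℝ => (p.1, 0)) (by fun_prop),
        fun _ => h1.differentiable 0,
        h1.continuous_fderiv.comp (f := fun p : Space d × ℝ => (p.1, 0)) (by fun_prop)⟩
    simpa [transport_one_zero, value] using h2.contDiff_integral 0 1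
  | cons v D ih =>
    obtain ⟨hv, hD⟩ := List.forall_mem_cons.1 hD
    obtain ⟨g, hg, hvg⟩ := hv.exists_c1Param hB y
    have h : (fun x => value B (v :: D) x y) = fun x => ∫ s in (0 : ℝ)..1,
        pexp B x (seg y x s) * g x s * value B D (seg y x s) y :=
      funext fun x => integral_congr_of_ne_zero fun s hs => by rw [hvg x s hs]
    rw [h]
    exact (c1Param_integrand hB y hg (ih hD)).contDiff_integral 0 1

/-- On the first line this is the field-strength formula, followed by an exchange of integrals and
rescaling if a vertex is present. For later lines the factor `s` raises the first vertex and
induction does the rest. -/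
theorem actLine_eq_value_diffLine {B : Fin d → Space d → A} (hB : ∀ μ, ContDiff ℝ ∞ (B μ))
    (y : Space d) (ρ : Fin d) {D : Diagram d} (hD : D.Admissible) {l : ℕ} (hl : l ≤ D.length)
    (x : Space d) : D.actLine B ρ l x y = (D.diffLine ρ l).value B x y := by
  have hB' : ∀ μ, Continuous (B μ) := fun μ => (hB μ).continuous
  have hform : ∀ (k : ℕ) (x : Space d), ∀ t ≠ 0,
      (⟨.circle [] ρ, k + 1⟩ : Vertex d).form B y t (seg y x t) =
      t ^ k • t • ∑ ν, (x ν - y ν) • fieldStrength B ν ρ (seg y x t) := by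
    intro k x t ht
    simp only [Vertex.form]
    rw [circleForm_nil_seg B y x ht, smul_smul, pow_succ]
  induction D generalizing l x with
  | nil =>
    obtain rfl : l = 0 := by simpa using hl
    have h := covariant_pd_transport hB y x 0 ρ
    simp only [transport_one_zero, zero_smul, sub_zero] at h
    simp only [actLine, covD]
    rw [h]
    refine integral_congr_of_ne_zero fun t ht => ?_
    change _ = pexp B x (seg y x t) * (⟨.circle [] ρ, 0 + 1⟩ : Vertex d).form B y t (seg y x t) *
      pexp B (seg y x t) y
    rw [hform 0 x t ht, pow_zero, one_smul, transport_one, transport, seg_zero]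
  | cons v D ih =>
    obtain ⟨hv, hD'⟩ := List.forall_mem_cons.1 hD
    cases l with
    | zero =>
      obtain ⟨g, hg, hvg⟩ := hv.exists_c1Param hB y
      have hVc : Continuous fun x => value B D x y := (contDiff_value hB y hD').continuous
      let p : ℝ → A := fun t => transport B y x 1 t *
        (t • ∑ ν, (x ν - y ν) • fieldStrength B ν ρ (seg y x t)) * transport B y x t 0
      let q : ℝ → A := fun s => transport B y x 0 s * g x s * value B D (seg y x s) y
      have hp : Continuous p := by
        have : ∀ ν, Continuous (fieldStrength B ν ρ) := fun ν =>
          (contDiff_fieldStrength hB ν ρ).continuous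
        fun_prop (disch := assumption)
      have hq : Continuous q := by
        have : Continuous (g x) := hg.continuous.comp (Continuous.prodMk_right x)
        have : Continuous fun s => value B D (seg y x s) y := hVc.comp (by fun_prop)
        fun_prop (disch := assumption)
      -- Routing the transport from `s` to `t` through parameter `0` separates the two variables, as
      -- the exchange of integrals requires.
      have hl : ∀ s, (∫ t in s..1, transport B y x 1 t *
          (t • ∑ ν, (x ν - y ν) • fieldStrength B ν ρ (seg y x t)) * transport B y x t s) =
          (∫ t in s..1, p t) * transport B y x 0 s := by
        intro s
        rw [← integral_mul_right_of_continuous hp]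
        refine intervalIntegral.integral_congr fun t _ => ?_
        simp only [p]
        rw [mul_assoc _ (transport B y x t 0), transport_mul hB']
      have hr : ∀ t ≠ 0, t ^ v.power • value B (v :: D) (seg y x t) y =
          transport B y x t 0 * ∫ s in (0 : ℝ)..t, q s := by
        intro t ht
        rw [pow_smul_value_cons_seg y x v D ht, ← integral_mul_left_of_continuous hq]
        refine integral_congr_of_ne_zero fun s hs => ?_
        simp only [q]
        rw [hvg x s hs, ← mul_assoc, ← mul_assoc, transport_mul hB']
      calc actLine B ρ (v :: D) 0 x y = ∫ s in (0 : ℝ)..1, (∫ t in s..1, p t) * q s := by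
            simp only [actLine, ← transport_one]
            refine integral_congr_of_ne_zero fun s hs => ?_
            rw [covariant_pd_transport hB, hl, hvg x s hs]
            simp only [q, mul_assoc]
        _ = ∫ t in (0 : ℝ)..1, p t * ∫ s in (0 : ℝ)..t, q s := integral_integral_mul_swap hp hq
        _ = _ := by
            refine integral_congr_of_ne_zero fun t ht => ?_
            change _ = pexp B x (seg y x t) *
              (⟨.circle [] ρ, v.power + 1⟩ : Vertex d).form B y t (seg y x t) *
              value B (v :: D) (seg y x t) y
            rw [hform _ x t ht, mul_smul_comm, smul_mul_assoc, ← mul_smul_comm, hr t ht,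
              ← transport_one, ← mul_assoc]
    | succ l =>
      change _ = value B (v.raise :: diffLine ρ D l) x y
      rw [value_cons]
      refine intervalIntegral.integral_congr fun s _ => ?_
      rw [ih hD' (by simpa using hl), Vertex.form_raise, mul_smul_comm, mul_smul_comm,
        smul_mul_assoc]

/-- The part is itself the value of an admissible diagram. This provides the integrability used in
the induction for `covD_value`. -/
theorem continuous_actLine {B : Fin d → Space d → A} (hB : ∀ μ, ContDiff ℝ ∞ (B μ))
    (y : Space d) (ρ : Fin d) {D : Diagram d} (hD : D.Admissible) {l : ℕ} (hl : l ≤ D.length) :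
    Continuous fun x => D.actLine B ρ l x y := by
  simp only [actLine_eq_value_diffLine hB y ρ hD hl]
  exact (contDiff_value hB y (hD.diffLine ρ l)).continuous

theorem continuous_actVertex {B : Fin d → Space d → A} (hB : ∀ μ, ContDiff ℝ ∞ (B μ))
    (y : Space d) (ρ : Fin d) {D : Diagram d} (hD : D.Admissible) (c : Fin D.length) :
    Continuous fun x => D.actVertex B ρ c x y := by
  cases hc : (D.get c).isCircle
  · simp only [actVertex_eq_zero B y ρ c hc]
    exact continuous_const
  · simp only [actVertex_eq_value_diffCircle B y ρ c hc]
    exact (contDiff_value hB y (hD.diffCircle ρ c)).continuous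

/-- The Leibniz rule for the integrand of a diagram with at least one vertex. -/
theorem covariant_leibniz_integrand {B : Fin d → Space d → A} (hB : ∀ μ, ContDiff ℝ ∞ (B μ))
    (y x : Space d) (ρ : Fin d) (v : Vertex d) {V : Space d → A} (hV : Differentiable ℝ V)
    (s : ℝ) :
    pd ρ (fun x => pexp B x (seg y x s) * v.form B y s (seg y x s) * V (seg y x s)) x +
        B ρ x * (pexp B x (seg y x s) * v.form B y s (seg y x s) * V (seg y x s)) =
      (pd ρ (fun x => pexp B x (seg y x s)) x + B ρ x * pexp B x (seg y x s)
          - s • (pexp B x (seg y x s) * B ρ (seg y x s))) * v.form B y s (seg y x s) *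
          V (seg y x s) +
        pexp B x (seg y x s) * (s • nabla B ρ (v.form B y s) (seg y x s)) * V (seg y x s) +
        pexp B x (seg y x s) * v.form B y s (seg y x s) * (s • covD B ρ V (seg y x s)) := by
  have h1 : DifferentiableAt ℝ (fun x => pexp B x (seg y x s)) x := by
    have := (transport_fderiv hB y).1.differentiable s x
    simpa only [transport_one] using this
  have h2' : Differentiable ℝ (v.form B y s) := (v.contDiff_form hB y s).differentiable (by simp)
  have hs : DifferentiableAt ℝ (fun x => seg y x s) x := (hasFDerivAt_seg y x s).differentiableAt
  have h2 : DifferentiableAt ℝ (fun x => v.form B y s (seg y x s)) x :=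
    DifferentiableAt.comp x (h2' _) hs
  have h3 : DifferentiableAt ℝ (fun x => V (seg y x s)) x := DifferentiableAt.comp x (hV _) hs
  rw [pd_mul ρ (DifferentiableAt.fun_mul h1 h2) h3, pd_mul ρ h1 h2, pd_comp_seg ρ (h2' _), pd_comp_seg ρ (hV _)]
  -- The terms with `B ρ` at `seg y x s` cancel: those on either side of the vertex come from the
  -- commutator and are offset by the line on the left and the value on the right.
  simp only [nabla, covD, smul_add, smul_sub, mul_add, add_mul, mul_sub, sub_mul, mul_smul_comm,
    smul_mul_assoc, mul_assoc]
  abel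

/-- Differentiate under the outermost integral and apply the Leibniz rule: the first line and first
vertex give the index-zero parts, and the covariant derivative of the remaining diagram is the
induction hypothesis. -/
theorem covD_value {B : Fin d → Space d → A} (hB : ∀ μ, ContDiff ℝ ∞ (B μ))
    (y : Space d) (ρ : Fin d) {D : Diagram d} (hD : D.Admissible) (x : Space d) :
    covD B ρ (fun x' => D.value B x' y) x =
      ∑ l ∈ Finset.range D.numLines, D.actLine B ρ l x y +
        ∑ c : Fin D.length, D.actVertex B ρ c x y := by
  induction D generalizing x with
  | nil => simp [numLines, actLine, value]
  | cons v D ih =>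
    obtain ⟨hv, hD'⟩ := List.forall_mem_cons.1 hD
    obtain ⟨g, hg, hvg⟩ := hv.exists_c1Param hB y
    obtain ⟨g', hg', hvg'⟩ := hv.exists_nabla_continuous hB y ρ x
    have hV := contDiff_value hB y hD'
    have hf := c1Param_integrand hB y hg hV
    have hT := (transport_fderiv hB y).1
    simp only [transport_one] at hT
    have hBc : ∀ μ, Continuous (B μ) := fun μ => (hB μ).continuous
    have hgc : Continuous (g x) := hg.continuous.comp (Continuous.prodMk_right x)
    have hVc : Continuous fun s => value B D (seg y x s) y := hV.continuous.comp (by fun_prop)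
    have hpd : Continuous fun s => pd ρ (fun x => pexp B x (seg y x s)) x :=
      (hT.continuous_fderiv.comp (Continuous.prodMk_right x)).clm_apply continuous_const
    have hfx : Continuous fun s => pexp B x (seg y x s) * g x s * value B D (seg y x s) y :=
      hf.continuous.comp (Continuous.prodMk_right x)
    have hdfx : Continuous fun s =>
        pd ρ (fun x => pexp B x (seg y x s) * g x s * value B D (seg y x s) y) x :=
      (hf.continuous_fderiv.comp (Continuous.prodMk_right x)).clm_apply continuous_const
    have hrest : ∀ {W : Space d → A}, Continuous W → IntervalIntegrable (fun s =>
        pexp B x (seg y x s) * v.form B y s (seg y x s) * (s • W (seg y x s)))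
        MeasureTheory.volume 0 1 := by
      intro W hW
      refine intervalIntegrable_of_eq_of_ne_zero
        (g := fun s => pexp B x (seg y x s) * g x s * (s • W (seg y x s)))
        (by fun_prop (disch := assumption)) fun s hs => ?_
      rw [hvg x s hs]
    have hline : IntervalIntegrable (fun s =>
        (pd ρ (fun x => pexp B x (seg y x s)) x + B ρ x * pexp B x (seg y x s)
          - s • (pexp B x (seg y x s) * B ρ (seg y x s))) * v.form B y s (seg y x s) *
          value B D (seg y x s) y) MeasureTheory.volume 0 1 := by
      refine intervalIntegrable_of_eq_of_ne_zero
        (g := fun s => (pd ρ (fun x => pexp B x (seg y x s)) x + B ρ x * pexp B x (seg y x s)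
          - s • (pexp B x (seg y x s) * B ρ (seg y x s))) * g x s *
          value B D (seg y x s) y) (by have := hBc ρ; fun_prop (disch := assumption))
        fun s hs => ?_
      rw [hvg x s hs]
    have hvert : IntervalIntegrable (fun s =>
        pexp B x (seg y x s) * (s • nabla B ρ (v.form B y s) (seg y x s)) *
          value B D (seg y x s) y) MeasureTheory.volume 0 1 := by
      refine intervalIntegrable_of_eq_of_ne_zero
        (g := fun s => pexp B x (seg y x s) * g' s * value B D (seg y x s) y)
        (by fun_prop (disch := assumption)) fun s hs => ?_
      rw [hvg' s hs]
    have hL : ∀ l ∈ Finset.range (numLines D), Continuous fun x => actLine B ρ D l x y :=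
      fun l hl => continuous_actLine hB y ρ hD' (Nat.lt_succ_iff.1 (Finset.mem_range.1 hl))
    have hC : ∀ c ∈ (Finset.univ : Finset (Fin D.length)),
        Continuous fun x => actVertex B ρ D c x y := fun c _ => continuous_actVertex hB y ρ hD' c
    -- After the induction hypothesis each summand is, by definition, the part with index shifted by
    -- one.
    have hsum : ∫ s in (0 : ℝ)..1, pexp B x (seg y x s) * v.form B y s (seg y x s) *
        (s • covD B ρ (fun x => value B D x y) (seg y x s)) =
        ∑ l ∈ Finset.range (numLines D), actLine B ρ (v :: D) (l + 1) x y +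
          ∑ c : Fin D.length, actVertex B ρ (v :: D) (c + 1) x y := by
      simp only [ih hD', smul_add, Finset.smul_sum, mul_add, Finset.mul_sum]
      rw [intervalIntegral.integral_add, intervalIntegral.integral_finsetSum,
        intervalIntegral.integral_finsetSum]
      · rfl
      · exact fun c hc => hrest (hC c hc)
      · exact fun l hl => hrest (hL l hl)
      · simpa only [Finset.sum_fn] using IntervalIntegrable.sum _ fun l hl => hrest (hL l hl)
      · simpa only [Finset.sum_fn] using IntervalIntegrable.sum _ fun c hc => hrest (hC c hc)
    have hcov : covD B ρ (fun x' => value B (v :: D) x' y) x = ∫ s in (0 : ℝ)..1,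
        (pd ρ (fun x => pexp B x (seg y x s) * v.form B y s (seg y x s) *
            value B D (seg y x s) y) x +
          B ρ x * (pexp B x (seg y x s) * v.form B y s (seg y x s) *
            value B D (seg y x s) y)) := by
      have e1 : (fun x' => value B (v :: D) x' y) = fun x => ∫ s in (0 : ℝ)..1,
          pexp B x (seg y x s) * g x s * value B D (seg y x s) y := by
        funext x'
        exact integral_congr_of_ne_zero fun s hs => by rw [hvg x' s hs]
      simp only [covD]
      rw [e1, congrFun e1 x, pd, hf.fderiv_integral_apply, ← integral_mul_left_of_continuous hfx]
      refine (intervalIntegral.integral_add (hdfx.intervalIntegrable _ _)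
        ((continuous_const.mul hfx).intervalIntegrable _ _)).symm.trans ?_
      -- For fixed `s ≠ 0` the C¹ representative equals the vertex form for all `x`, so the
      -- derivatives in `x` agree too.
      refine integral_congr_of_ne_zero fun s hs => ?_
      simp only [hvg _ s hs]
      rfl
    rw [hcov]
    simp only [covariant_leibniz_integrand hB y x ρ v (hV.differentiable one_ne_zero)]
    rw [intervalIntegral.integral_add (hline.add hvert), intervalIntegral.integral_add hline hvert,
      hsum]
    · rw [show numLines (v :: D) = numLines D + 1 from rfl, Finset.sum_range_succ']
      rw [show ∑ c : Fin (v :: D).length, actVertex B ρ (v :: D) c x y =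
        actVertex B ρ (v :: D) 0 x y + ∑ c : Fin D.length, actVertex B ρ (v :: D) (c + 1) x y from
          Fin.sum_univ_succ _]
      simp only [actLine, actVertex]
      abel
    · simp only [ih hD']
      exact hrest (W := fun z => ∑ l ∈ Finset.range (numLines D), actLine B ρ D l z y +
        ∑ c : Fin D.length, actVertex B ρ D c z y)
        ((continuous_finsetSum _ hL).add (continuous_finsetSum _ hC))

/-- The parts match the listed diagrams one by one; the crosses omitted by the filter contribute
zero. -/
theorem sum_act_eq_sum_derivative {B : Fin d → Space d → A} (hB : ∀ μ, ContDiff ℝ ∞ (B μ))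
    (y : Space d) (ρ : Fin d) {D : Diagram d} (hD : D.Admissible) (x : Space d) :
    ∑ l ∈ Finset.range D.numLines, D.actLine B ρ l x y +
        ∑ c : Fin D.length, D.actVertex B ρ c x y =
      ((D.derivative ρ).map fun D' => D'.value B x y).sum := by
  have hrange : ∀ (n : ℕ) (f : ℕ → A),
      ∑ l ∈ Finset.range n, f l = ((List.range n).map f).sum := fun _ _ => rfl
  have hfilter : ∀ (L : List (Fin D.length)),
      (L.map fun c : Fin D.length => actVertex B ρ D c x y).sum =
      ((L.filter fun c => (D.get c).isCircle).map fun c => (D.diffCircle ρ c).value B x y).sum := by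
    intro L
    induction L with
    | nil => rfl
    | cons c L ih =>
      cases hc : (D.get c).isCircle
      · rw [List.filter_cons_of_neg (by rw [hc]; exact Bool.false_ne_true), List.map_cons, List.sum_cons,
          actVertex_eq_zero B y ρ c hc, zero_add, ih]
      · rw [List.filter_cons_of_pos (p := fun c => (D.get c).isCircle) hc, List.map_cons, List.sum_cons, List.map_cons, List.sum_cons,
          actVertex_eq_value_diffCircle B y ρ c hc, ih]
  simp only [derivative, List.map_append, List.sum_append, List.map_map]
  rw [Fin.sum_univ_def, hfilter, hrange]
  congr 2
  exact List.map_congr_left fun l hl =>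
    actLine_eq_value_diffLine hB y ρ hD (Nat.lt_succ_iff.1 (List.mem_range.1 hl)) x

end Diagram

end HeatDiagram

theorem theorem1 {𝕜 : Type*} [RCLike 𝕜] (d N : ℕ)
    (B : Fin d → HeatDiagram.Space d → Matrix (Fin N) (Fin N) 𝕜)
    (hB : ∀ μ, ContDiff ℝ ∞ (B μ))
    (D : HeatDiagram.Diagram d) (hD : D.Admissible) (y : HeatDiagram.Space d) :
    -- the function represented by the diagram is differentiable
    Differentiable ℝ (fun x => D.value B x y) ∧
    ∀ ρ : Fin d,
      -- the derivative acts on the lines and on the vertices, one at a time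
      (∀ x, HeatDiagram.covD B ρ (fun x' => D.value B x' y) x =
        ∑ l ∈ Finset.range D.numLines, D.actLine B ρ l x y +
          ∑ c : Fin D.length, D.actVertex B ρ c x y) ∧
      -- acting on a line
      (∀ l < D.numLines, ∀ x, D.actLine B ρ l x y = (D.diffLine ρ l).value B x y) ∧
      -- acting on a circle
      (∀ c : Fin D.length, (D.get c).isCircle = true →
        ∀ x, D.actVertex B ρ c x y = (D.diffCircle ρ c).value B x y) ∧
      -- acting on a cross
      (∀ c : Fin D.length, (D.get c).isCircle = false →
        ∀ x, D.actVertex B ρ c x y = 0) ∧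
      -- the result is a sum of diagrams, one for each line and one for each circle
      (D.derivative ρ).length = D.numLines + D.numCircles ∧
      (∀ D' ∈ D.derivative ρ, D'.Admissible) ∧
      (∀ x, HeatDiagram.covD B ρ (fun x' => D.value B x' y) x =
        ((D.derivative ρ).map fun D' => D'.value B x y).sum) := by
  have hV := HeatDiagram.Diagram.contDiff_value hB y hD
  refine ⟨hV.differentiable one_ne_zero, fun ρ => ⟨HeatDiagram.Diagram.covD_value hB y ρ hD, ?_, ?_, ?_, ?_, ?_, ?_⟩⟩
  · exact fun l hl => HeatDiagram.Diagram.actLine_eq_value_diffLine hB y ρ hD (Nat.lt_succ_iff.1 hl)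
  · exact fun c hc => HeatDiagram.Diagram.actVertex_eq_value_diffCircle B y ρ c hc
  · exact fun c hc => HeatDiagram.Diagram.actVertex_eq_zero B y ρ c hc
  · exact HeatDiagram.Diagram.length_derivative ρ D
  · exact hD.derivative ρ
  · exact fun x => (HeatDiagram.Diagram.covD_value hB y ρ hD x).trans
      (HeatDiagram.Diagram.sum_act_eq_sum_derivative hB y ρ hD x)
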